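/- Let $d\neq 1$ be a square-free integer, $K=\mathbb Q(\sqrt d)$, $\mathcal O$ the ring of integers of $K$, $\Delta$ the discriminant of $K$, $\mathfrak p\subset\mathcal O$ a nonzero prime ideal, $p$ the prime number with $\mathfrak p\cap\mathbb Z=p\mathbb Z$, and $G$ a finite abelian group with $p\nmid\exp(G)$. A ring is *clean* if each of its elements is the sum of a unit and an idempotent. The group ring $\mathcal O_{\mathfrak p}[G]$ over the localization $\mathcal O_{\mathfrak p}$ carries the involution $(\sum a_g g)^*=\sum a_g g^{-1}$, and it is *$*$-clean* if each of its elements is the sum of a unit and a projection, i.e. an element $e$ with $e^*=e=e^2$. Write $\left(\frac{\Delta}{p}\right)$ for the Kronecker symbol: the Legendre symbol if $p$ is odd, and for $p=2$ it is $0$ if $\Delta$ is even, $1$ if $\Delta\equiv 1\pmod 8$ and $-1$ if $\Delta\equiv 5\pmod 8$. Suppose first that $\exp(G)\ge 3$. 1. If $d>0$, then $\mathcal O_{\mathfrak p}[G]$ is $*$-clean if and only if $\mathcal O_{\mathfrak p}[G]$ is clean. 2. If $d<0$, then $\mathcal O_{\mathfrak p}[G]$ is $*$-clean if and only if $\Delta\nmid\exp(G)$,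 $p$ is a primitive root modulo $\exp(G)$ (that is, the order of $p$ in $(\mathbb Z/\exp(G)\mathbb Z)^\times$ is $\varphi(\exp(G))$), and $\left(\frac{\Delta}{p}\right)\in\{0,1\}$. If instead $\exp(G)\le 2$, then the involution is the identity and $\mathcal O_{\mathfrak p}[G]$ is always $*$-clean. -/

import Mathlib

/-- A ring is clean if every element is the sum of a unit and an idempotent. -/
def IsCleanRing (R : Type*) [Ring R] : Prop :=
  ∀ a : R, ∃ u e : R, IsUnit u ∧ IsIdempotentElem e ∧ a = u + e

/-- A ring with involution is `*`-clean if every element is the sum of a unit and a projection,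
that is, an element `e` with `star e = e = e * e`. -/
def IsStarCleanRing (R : Type*) [Ring R] [StarRing R] : Prop :=
  ∀ a : R, ∃ u e : R, IsUnit u ∧ IsStarProjection e ∧ a = u + e

/-- The classical involution `∑ a_g g ↦ ∑ a_g g⁻¹` on the group ring of an abelian group.
It does not act on the coefficients. -/
noncomputable instance MonoidAlgebra.classicalStarRing (R G : Type*) [CommRing R] [CommGroup G] :
    StarRing (MonoidAlgebra R G) where
  star x := MonoidAlgebra.mapDomain (fun g : G => g⁻¹) x
  star_involutive x := by
    induction x using MonoidAlgebra.induction_linear with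
    | zero => simp
    | add x y hx hy => simp only [MonoidAlgebra.mapDomain_add, hx, hy]
    | single g r => simp
  star_mul x y := by
    rw [mul_comm x y]
    exact MonoidAlgebra.mapDomain_mul (invMonoidHom : G →* G) y x
  star_add x y := MonoidAlgebra.mapDomain_add _ x y

theorem MonoidAlgebra.star_single_eq (R G : Type*) [CommRing R] [CommGroup G] (g : G) (r : R) :
    star (MonoidAlgebra.single g r) = MonoidAlgebra.single g⁻¹ r :=
  MonoidAlgebra.mapDomain_single

/-- The Kronecker symbol `(a / p)` for a prime `p`: the Legendre symbol if `p` is odd, and for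
`p = 2` the value `0` if `a` is even, `1` if `a ≡ ±1 mod 8`, and `-1` if `a ≡ ±3 mod 8`. -/
def kroneckerAtPrime (a : ℤ) (p : ℕ) [Fact p.Prime] : ℤ :=
  if p = 2 then ZMod.χ₈ (a : ZMod 8) else legendreSym p a

/-! Let n = exp(G), let R be the localization, k its residue field and q = |k|. Apart from the case
d > 0, everything turns on whether q generates (ℤ/n)ˣ.

Sufficiency (`isStarCleanRing_of_orderOf_eq_totient`). The reduction R[G] → k[G] detects units, and
every element of the finite ring k[G] is a unit plus an idempotent, so it is enough to lift
idempotents of k[G] to projections. An idempotent is fixed by Frobenius, so its coefficients are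
constant along g ↦ g^q. If q generates (ℤ/n)ˣ, they depend only on the subgroup ⟨g⟩, and the
idempotent is a combination of subgroup averages. These are projections already over R, and
`exists_isStarProjection_map_eq` assembles the lift.

Necessity for d < 0 (`IsStarCleanRing.orderOf_eq_totient`). If R[G] is *-clean, every idempotent of
k[G] lifts to a projection. Over ℂ an idempotent has e(g⁻¹) equal to the conjugate of e(g), so a
projection has real, hence rational, coefficients. Rational idempotents are invariant under g ↦ g^j
for all j prime to n; so is then every idempotent of k[G], which forces q to generate. For d > 0 the
same conjugation identity makes every idempotent self-adjoint, so clean and *-clean agree.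

Arithmetic. Here q is p or p². For n ≥ 3, φ(n) is even, so p² cannot generate; thus q = p, which
means (Δ/p) ≠ -1, and p is a primitive root. Then Δ ∤ n is automatic: some power of p is -1 mod n,
while for Δ < 0 the character (Δ/·) takes the value -1 at -1. For n ≤ 2 the group (ℤ/n)ˣ is trivial.
-/

namespace MonoidAlgebra

/-! ### Group rings and their reductions -/

section Basic

variable {R S G : Type*} [CommRing R] [CommRing S] [CommGroup G]

theorem coeff_star (x : MonoidAlgebra R G) (g : G) : (star x).coeff g = x.coeff g⁻¹ := by
  have : (star x).coeff (g⁻¹)⁻¹ = x.coeff g⁻¹ :=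
    Finsupp.mapDomain_apply inv_injective x.coeff g⁻¹
  rwa [inv_inv] at this

theorem mapRingHom_injective {f : R →+* S} (hf : Function.Injective f) :
    Function.Injective (mapRingHom G f) := fun x y h => by
  ext g
  apply hf
  rw [← coeff_mapRingHom, h, coeff_mapRingHom]

theorem mapRingHom_surjective {f : R →+* S} (hf : Function.Surjective f) :
    Function.Surjective (mapRingHom G f) :=
  map_surjective f.toAddMonoidHom hf

end Basic

/-- A group ring element over a local ring is a unit as soon as its reduction is. -/
theorem isUnit_of_isUnit_mapRingHom_residue {R G : Type*} [CommRing R] [IsLocalRing R]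
    [CommGroup G] [Finite G] (x : MonoidAlgebra R G)
    (h : IsUnit (mapRingHom G (IsLocalRing.residue R) x)) : IsUnit x := by
  by_contra hx
  obtain ⟨M, hM, hxM⟩ := exists_max_ideal_of_mem_nonunits hx
  -- R[G] is integral over R, so every maximal ideal lies over the maximal ideal of R and therefore
  -- contains the kernel of the reduction.
  have hcomap : M.comap (algebraMap R (MonoidAlgebra R G)) = IsLocalRing.maximalIdeal R :=
    IsLocalRing.eq_maximalIdeal (Ideal.isMaximal_comap_of_isIntegral_of_isMaximal M)
  obtain ⟨y', hy'⟩ := h.exists_right_inv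
  obtain ⟨y, rfl⟩ := mapRingHom_surjective IsLocalRing.residue_surjective y'
  rw [← map_mul] at hy'
  have hker : ∀ z : MonoidAlgebra R G, mapRingHom G (IsLocalRing.residue R) z = 0 → z ∈ M := by
    intro z hz
    rw [← sum_coeff_single z]
    refine Ideal.sum_mem _ fun g _ => ?_
    have hg : z.coeff g ∈ IsLocalRing.maximalIdeal R := by
      rw [← IsLocalRing.residue_eq_zero_iff, ← coeff_mapRingHom, hz]
      rfl
    rw [← hcomap, Ideal.mem_comap] at hg
    have : single g (z.coeff g) = algebraMap R (MonoidAlgebra R G) (z.coeff g) * single g 1 := by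
      simp [single_mul_single]
    rw [this]
    exact M.mul_mem_right _ hg
  have h1 := hker (x * y - 1) (by rw [map_sub, hy', map_one, sub_self])
  apply hM.ne_top
  rw [Ideal.eq_top_iff_one]
  have := M.sub_mem (M.mul_mem_right y hxM) h1
  simpa using this

end MonoidAlgebra

/-! ### Lifting idempotents to projections -/

section Projections

theorem IsStarProjection.mul_of_comm {A : Type*} [CommRing A] [StarRing A] {e f : A}
    (he : IsStarProjection e) (hf : IsStarProjection f) : IsStarProjection (e * f) where
  isIdempotentElem := he.isIdempotentElem.mul hf.isIdempotentElem
  isSelfAdjoint := by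
    rw [IsSelfAdjoint, star_mul, he.isSelfAdjoint.star_eq, hf.isSelfAdjoint.star_eq, mul_comm]

theorem IsStarProjection.add_of_orthogonal {A : Type*} [CommRing A] [StarRing A] {e f : A}
    (he : IsStarProjection e) (hf : IsStarProjection f) (h : e * f = 0) :
    IsStarProjection (e + f) where
  isIdempotentElem := by
    have h1 : e * e = e := he.isIdempotentElem
    have h2 : f * f = f := hf.isIdempotentElem
    rw [IsIdempotentElem]
    linear_combination h1 + h2 + 2 * h
  isSelfAdjoint := he.isSelfAdjoint.add hf.isSelfAdjoint

variable {k A B ι : Type*} [Field k] [CommRing A] [StarRing A] [CommRing B] [Algebra k B]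

/-- Idempotents below a projection which are combinations of images of projections lift. -/
theorem exists_isStarProjection_map_eq_mul (φ : A →+* B) (s : Finset ι) (e : ι → A)
    (he : ∀ i, IsStarProjection (e i)) (f : B) (hf : IsIdempotentElem f) (c : ι → k) :
    ∀ (P : A) (c₀ : k), IsStarProjection P →
      f * φ P = (∑ i ∈ s, c i • φ (e i)) * φ P + c₀ • φ P →
      ∃ E, IsStarProjection E ∧ E * P = E ∧ φ E = f * φ P := by
  classical
  induction s using Finset.induction_on with
  | empty =>
    intro P c₀ hP h
    rw [Finset.sum_empty, zero_mul, zero_add] at h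
    -- Here f · φ P is a scalar multiple of φ P; being idempotent, it is 0 or φ P itself.
    by_cases hc : c₀ = 0
    · exact ⟨0, .zero _, zero_mul _, by rw [h, hc, zero_smul, map_zero]⟩
    · refine ⟨P, hP, hP.isIdempotentElem, ?_⟩
      have hPP : φ P * φ P = φ P := by rw [← map_mul, hP.isIdempotentElem]
      have h2 : f * (f * φ P) = f * φ P := by rw [← mul_assoc, hf]
      rw [h, mul_smul_comm, h] at h2
      have := congrArg (fun x => c₀⁻¹ • x) h2
      simp only [inv_smul_smul₀ hc] at this
      rw [h, this]
  | insert j s hj ih =>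
    intro P c₀ hP h
    have hej : φ (e j) * φ (e j) = φ (e j) := by
      rw [← map_mul, (he j).isIdempotentElem]
    rw [Finset.sum_insert hj] at h
    simp only [Algebra.smul_def] at h ih
    -- Split P along e j: on P · e j the image of e j acts as 1, so c j joins the constant term; on
    -- the complement it acts as 0.
    obtain ⟨E₁, h₁, h₁P, h₁f⟩ := ih (P * e j) (c₀ + c j) (hP.mul_of_comm (he j)) (by
      rw [map_mul, map_add]
      linear_combination φ (e j) * h + algebraMap k B (c j) * φ P * hej)
    obtain ⟨E₂, h₂, h₂P, h₂f⟩ := ih (P * (1 - e j)) c₀ (hP.mul_of_comm (he j).one_sub) (by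
      rw [map_mul, map_sub, map_one]
      linear_combination (1 - φ (e j)) * h - algebraMap k B (c j) * φ P * hej)
    have hE : e j * e j = e j := (he j).isIdempotentElem
    have hPP : P * P = P := hP.isIdempotentElem
    refine ⟨E₁ + E₂, h₁.add_of_orthogonal h₂ ?_, ?_, ?_⟩
    · rw [← h₁P, ← h₂P]
      linear_combination -E₁ * P * P * E₂ * hE
    · rw [add_mul]
      congr 1
      · nth_rw 1 [← h₁P]
        linear_combination h₁P + E₁ * e j * hPP
      · nth_rw 1 [← h₂P]
        linear_combination h₂P + E₂ * (1 - e j) * hPP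
    · rw [map_add, h₁f, h₂f, map_mul, map_mul, map_sub, map_one]
      ring

theorem exists_isStarProjection_map_eq (φ : A →+* B) (s : Finset ι) (e : ι → A)
    (he : ∀ i, IsStarProjection (e i)) (f : B) (hf : IsIdempotentElem f) (c : ι → k)
    (h : f = ∑ i ∈ s, c i • φ (e i)) : ∃ E, IsStarProjection E ∧ φ E = f := by
  obtain ⟨E, hE, -, hE'⟩ := exists_isStarProjection_map_eq_mul φ s e he f hf c 1 0 (.one _)
    (by simpa using h)
  exact ⟨E, hE, by simpa using hE'⟩

/-- In a finite commutative ring every element is the sum of a unit and an idempotent. -/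
theorem exists_isIdempotentElem_isUnit_sub {F : Type*} [CommRing F] [Finite F] (a : F) :
    ∃ f, IsIdempotentElem f ∧ IsUnit (a - f) := by
  obtain ⟨N, hN, hid⟩ : ∃ N : ℕ, 0 < N ∧ IsIdempotentElem (a ^ N) := by
    obtain ⟨m, n, hne, h⟩ := Finite.exists_ne_map_eq_of_infinite (fun i : ℕ => a ^ i)
    wlog hlt : m < n generalizing m n
    · exact this n m hne.symm h.symm (by omega)
    obtain ⟨t, rfl⟩ := Nat.exists_eq_add_of_lt hlt
    have h' : a ^ m = a ^ (m + t + 1) := h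
    have hper : ∀ i j : ℕ, m ≤ i → a ^ (i + (t + 1) * j) = a ^ i := by
      intro i j hi
      induction j with
      | zero => rfl
      | succ j ih =>
        obtain ⟨l, rfl⟩ := Nat.exists_eq_add_of_le hi
        calc a ^ (m + l + (t + 1) * (j + 1)) = a ^ (m + t + 1) * a ^ (l + (t + 1) * j) := by
              rw [← pow_add]; ring_nf
          _ = a ^ m * a ^ (l + (t + 1) * j) := by rw [← h']
          _ = a ^ (m + l + (t + 1) * j) := by rw [← pow_add]; ring_nf
          _ = _ := ih
    -- A multiple of the period t + 1 that is at least m, so doubling the exponent does not change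
    -- the power.
    refine ⟨(t + 1) * (m + 1), by positivity, ?_⟩
    rw [IsIdempotentElem, ← pow_add]
    exact hper _ _ (by nlinarith)
  -- Modulo a maximal ideal this idempotent is 1 if a vanishes there and 0 otherwise, so the
  -- difference never vanishes.
  refine ⟨1 - a ^ N, hid.one_sub, ?_⟩
  by_contra hu
  obtain ⟨M, hM, hmem⟩ := exists_max_ideal_of_mem_nonunits hu
  have hprod : a ^ N * (1 - a ^ N) ∈ M := by
    rw [mul_sub, mul_one, hid, sub_self]; exact M.zero_mem
  apply hM.ne_top
  rw [Ideal.eq_top_iff_one]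
  rcases hM.isPrime.mem_or_mem hprod with h | h
  · have ha := hM.isPrime.mem_of_pow_mem N h
    have := M.sub_mem (M.add_mem ha h) hmem
    ring_nf at this
    exact this
  · have ha : a ∈ M := by simpa using M.add_mem hmem h
    have := M.add_mem h (M.pow_mem_of_mem ha N hN)
    simpa using this

end Projections

/-! ### Frobenius on group rings over finite fields -/

namespace MonoidAlgebra

section FiniteField

variable {k G : Type*} [Field k] [Fintype k] [CommGroup G]

theorem pow_card_eq_mapDomain (x : MonoidAlgebra k G) :
    x ^ Fintype.card k = mapDomain (fun g : G => g ^ Fintype.card k) x := by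
  change FiniteField.frobeniusAlgHom k (MonoidAlgebra k G) x = _
  induction x using MonoidAlgebra.induction_linear with
  | zero => simp
  | add x y hx hy => rw [map_add, hx, hy, mapDomain_add]
  | single g r => simp [single_pow, FiniteField.pow_card]

/-- Frobenius fixes the scalars and moves g to g^q, which is injective on G by coprimality; compare
coefficients in x^q = x. -/
theorem coeff_pow_card [Finite G] (hG : (Fintype.card k).Coprime (Monoid.exponent G))
    {x : MonoidAlgebra k G} (hx : x ^ Fintype.card k = x) (g : G) :
    x.coeff (g ^ Fintype.card k) = x.coeff g := by
  conv_lhs => rw [← hx, pow_card_eq_mapDomain]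
  have hinj : Function.Injective (fun g : G => g ^ Fintype.card k) := by
    refine (powMonoidHom (Fintype.card k) : G →* G).ker_eq_bot_iff.mp ?_
    rw [eq_bot_iff]
    intro g hg
    have h1 : orderOf g ∣ Fintype.card k := orderOf_dvd_of_pow_eq_one hg
    have h2 := hG.symm.coprime_dvd_left (Monoid.order_dvd_exponent g)
    rw [Subgroup.mem_bot, ← orderOf_eq_one_iff]
    exact Nat.eq_one_of_dvd_coprimes h2 dvd_rfl h1
  exact Finsupp.mapDomain_apply hinj x.coeff g

end FiniteField

/-! ### Subgroup sums and averages -/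

section SubgroupSum

variable (R : Type*) {G : Type*} [CommRing R] [CommGroup G] [Fintype G]

open Classical in
/-- The sum of the elements of a subgroup, in the group ring. -/
noncomputable def subgroupSum (H : Subgroup G) : MonoidAlgebra R G :=
  ∑ g : G, if g ∈ H then single g 1 else 0

theorem single_mul_subgroupSum {H : Subgroup G} {h : G} (hh : h ∈ H) :
    single h 1 * subgroupSum R H = subgroupSum R H := by
  rw [subgroupSum, Finset.mul_sum]
  refine Fintype.sum_equiv (Equiv.mulLeft h) _ _ fun g => ?_
  have hmem := H.mul_mem_cancel_left hh (y := g)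
  by_cases hg : g ∈ H
  · simp [hg, hmem.mpr hg, single_mul_single]
  · simp [hg, mt hmem.mp hg]

theorem subgroupSum_mul_self (H : Subgroup G) :
    subgroupSum R H * subgroupSum R H = (Nat.card H : R) • subgroupSum R H := by
  classical
  nth_rw 1 [subgroupSum]
  rw [Finset.sum_mul]
  have : ∀ g : G, (if g ∈ H then single g (1 : R) else 0) * subgroupSum R H =
      if g ∈ H then subgroupSum R H else 0 := fun g => by
    split_ifs with h
    · exact single_mul_subgroupSum R h
    · exact zero_mul _
  rw [Finset.sum_congr rfl fun g _ => this g, ← Finset.sum_filter, Finset.sum_const,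
    ← Nat.cast_smul_eq_nsmul R]
  congr 2
  rw [Nat.card_eq_fintype_card, Fintype.card_subtype]

theorem star_subgroupSum (H : Subgroup G) : star (subgroupSum R H) = subgroupSum R H := by
  rw [subgroupSum, star_sum]
  refine Fintype.sum_equiv (Equiv.inv G) _ _ fun g => ?_
  split_ifs with h1 h2 h2
  · rw [star_single_eq]; rfl
  · exact absurd (H.inv_mem h1) h2
  · exact absurd (H.inv_mem_iff.mp h2) h1
  · exact star_zero _

theorem mapRingHom_subgroupSum {S : Type*} [CommRing S] (f : R →+* S) (H : Subgroup G) :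
    mapRingHom G f (subgroupSum R H) = subgroupSum S H := by
  simp only [subgroupSum, map_sum]
  refine Finset.sum_congr rfl fun g _ => ?_
  split_ifs <;> simp

/-- The projection onto the invariants of a subgroup of invertible order. -/
noncomputable def subgroupAverage (H : Subgroup G) : MonoidAlgebra R G :=
  Ring.inverse (Nat.card H : R) • subgroupSum R H

theorem isStarProjection_subgroupAverage {H : Subgroup G} (hH : IsUnit (Nat.card H : R)) :
    IsStarProjection (subgroupAverage R H) where
  isIdempotentElem := by
    rw [IsIdempotentElem, subgroupAverage, smul_mul_smul_comm, subgroupSum_mul_self, smul_smul,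
      mul_assoc, Ring.inverse_mul_cancel _ hH, mul_one]
  isSelfAdjoint := by
    rw [IsSelfAdjoint, subgroupAverage, Algebra.smul_def, star_mul, star_subgroupSum, mul_comm]
    congr 1
    simp [star_single_eq]

theorem smul_subgroupAverage {H : Subgroup G} (hH : IsUnit (Nat.card H : R)) :
    (Nat.card H : R) • subgroupAverage R H = subgroupSum R H := by
  rw [subgroupAverage, smul_smul, Ring.mul_inverse_cancel _ hH, one_smul]

open Classical in
/-- Elements whose coefficients only depend on the generated cyclic subgroup are combinations of
subgroup sums. -/
theorem mem_span_subgroupSum {x : MonoidAlgebra R G}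
    (hx : ∀ g h : G, Subgroup.zpowers g = Subgroup.zpowers h → x.coeff g = x.coeff h) :
    x ∈ Submodule.span R (Set.range (subgroupSum R : Subgroup G → MonoidAlgebra R G)) := by
  -- Möbius inversion on the subgroup lattice: the sum of the generators of C is the sum over C
  -- minus the same sums for the proper subgroups of C.
  have hT : ∀ C : Subgroup G,
      (∑ g : G, if Subgroup.zpowers g = C then single g (1 : R) else 0) ∈
        Submodule.span R (Set.range (subgroupSum R : Subgroup G → MonoidAlgebra R G)) := by
    intro C
    induction C using WellFoundedLT.induction with
    | ind C ih =>
      have h1 : subgroupSum R C = ∑ D ∈ Finset.univ.filter (fun D : Subgroup G => D ≤ C),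
          ∑ g : G, if Subgroup.zpowers g = D then single g (1 : R) else 0 := by
        rw [Finset.sum_comm, subgroupSum]
        refine Finset.sum_congr rfl fun g _ => ?_
        rw [Finset.sum_ite_eq]
        simp
      have h2 : (Finset.univ.filter fun D : Subgroup G => D ≤ C) =
          insert C (Finset.univ.filter fun D : Subgroup G => D < C) := by
        ext D
        simp [le_iff_eq_or_lt]
      rw [h2, Finset.sum_insert (by simp)] at h1
      rw [eq_sub_of_add_eq h1.symm]
      refine Submodule.sub_mem _ (Submodule.subset_span ⟨C, rfl⟩) (Submodule.sum_mem _ fun D hD => ?_)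
      exact ih D (Finset.mem_filter.mp hD).2
  have h : x = ∑ C : Subgroup G, ∑ g : G,
      if Subgroup.zpowers g = C then single g (x.coeff g) else 0 := by
    rw [Finset.sum_comm]
    simp only [Finset.sum_ite_eq, Finset.mem_univ, if_true]
    conv_lhs => rw [← sum_coeff_single x]
    exact Finsupp.sum_fintype _ _ fun g => single_zero g
  rw [h]
  refine Submodule.sum_mem _ fun C _ => ?_
  by_cases hC : ∃ g₀ : G, Subgroup.zpowers g₀ = C
  · obtain ⟨g₀, hg₀⟩ := hC
    convert! Submodule.smul_mem _ (x.coeff g₀) (hT C) using 1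
    rw [Finset.smul_sum]
    refine Finset.sum_congr rfl fun g _ => ?_
    split_ifs with hg
    · rw [smul_single, smul_eq_mul, mul_one, hx g g₀ (hg.trans hg₀.symm)]
    · exact (smul_zero _).symm
  · convert! Submodule.zero_mem _ using 1
    exact Finset.sum_eq_zero fun g _ => if_neg fun hg => hC ⟨g, hg⟩

end SubgroupSum

end MonoidAlgebra

/-! ### Sufficiency of the generator condition -/

theorem ZMod.mem_powers_of_orderOf_eq_totient {n q : ℕ} [NeZero n] (hqn : q.Coprime n)
    (hq : orderOf (q : ZMod n) = n.totient) (u : (ZMod n)ˣ) : ∃ i : ℕ, (q : ZMod n) ^ i = u := by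
  have h1 : orderOf (ZMod.unitOfCoprime q hqn) = Nat.card (ZMod n)ˣ := by
    rw [Nat.card_eq_fintype_card, ZMod.card_units_eq_totient, ← hq, ← orderOf_units,
      ZMod.coe_unitOfCoprime]
  have : u ∈ Subgroup.zpowers (ZMod.unitOfCoprime q hqn) := by
    rw [Subgroup.eq_top_of_card_eq _ ((Nat.card_zpowers _).trans h1)]
    trivial
  rw [← mem_powers_iff_mem_zpowers] at this
  obtain ⟨i, hi⟩ := this
  exact ⟨i, by rw [← hi]; simp⟩

/-- Write h = g^j with j prime to the order of g. The class of j lifts to a unit modulo exp(G),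
because reduction of unit groups is surjective, and that unit is a power of q. -/
theorem exists_pow_eq_of_zpowers_eq {G : Type*} [CommGroup G] [Finite G] {q : ℕ}
    (hqn : q.Coprime (Monoid.exponent G))
    (hq : orderOf (q : ZMod (Monoid.exponent G)) = (Monoid.exponent G).totient)
    {g h : G} (hgh : Subgroup.zpowers g = Subgroup.zpowers h) : ∃ i : ℕ, g ^ q ^ i = h := by
  have hn : NeZero (Monoid.exponent G) := ⟨Monoid.exponent_ne_zero_of_finite⟩
  have ho : NeZero (orderOf g) := ⟨(orderOf_pos g).ne'⟩
  obtain ⟨j, rfl⟩ : ∃ j : ℕ, g ^ j = h := by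
    have : h ∈ Subgroup.zpowers g := hgh ▸ Subgroup.mem_zpowers h
    rwa [← mem_powers_iff_mem_zpowers] at this
  have hj : j.Coprime (orderOf g) := by
    have h1 : orderOf (g ^ j) = orderOf g := by
      rw [← Nat.card_zpowers, ← Nat.card_zpowers, hgh]
    rw [orderOf_pow] at h1
    exact (Nat.Coprime.symm ((Nat.div_eq_self.mp h1).resolve_left (orderOf_pos g).ne'))
  obtain ⟨u, hu⟩ := ZMod.unitsMap_surjective (Monoid.order_dvd_exponent g)
    (ZMod.unitOfCoprime j hj)
  obtain ⟨i, hi⟩ := ZMod.mem_powers_of_orderOf_eq_totient hqn hq u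
  refine ⟨i, ?_⟩
  rw [pow_eq_pow_iff_modEq, ← ZMod.natCast_eq_natCast_iff]
  have := congrArg (ZMod.castHom (Monoid.order_dvd_exponent g) (ZMod (orderOf g))) hi
  rw [map_pow, map_natCast] at this
  push_cast
  rw [this]
  have h3 := congrArg Units.val hu
  rw [ZMod.coe_unitOfCoprime] at h3
  rw [← h3]
  rfl

/-- If the cardinality of the residue field generates `(ℤ/exp(G))ˣ`, then the group ring is
`*`-clean. -/
theorem isStarCleanRing_of_orderOf_eq_totient {R G : Type*} [CommRing R] [IsLocalRing R]
    [Fintype (IsLocalRing.ResidueField R)] [CommGroup G] [Finite G]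
    (hqn : (Fintype.card (IsLocalRing.ResidueField R)).Coprime (Monoid.exponent G))
    (hq : orderOf (Fintype.card (IsLocalRing.ResidueField R) : ZMod (Monoid.exponent G)) =
      (Monoid.exponent G).totient) :
    IsStarCleanRing (MonoidAlgebra R G) := by
  classical
  have := Fintype.ofFinite G
  have hcard : ∀ H : Subgroup G, (Nat.card H : (IsLocalRing.ResidueField R)) ≠ 0 := by
    intro H h0
    obtain ⟨p, hp⟩ := CharP.exists (IsLocalRing.ResidueField R)
    obtain ⟨r, hpp, hr⟩ := FiniteField.card (IsLocalRing.ResidueField R) p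
    rw [CharP.cast_eq_zero_iff (IsLocalRing.ResidueField R) p] at h0
    have h1 : p ∣ Monoid.exponent G :=
      by
        have := Fact.mk hpp
        obtain ⟨x, hx⟩ := exists_prime_orderOf_dvd_card' p (h0.trans H.card_subgroup_dvd_card)
        exact hx ▸ Monoid.order_dvd_exponent x
    have h2 : p ∣ Fintype.card (IsLocalRing.ResidueField R) := hr ▸ dvd_pow_self p r.pos.ne'
    exact hpp.one_lt.ne' (Nat.eq_one_of_dvd_coprimes hqn h2 h1)
  have hunit : ∀ H : Subgroup G, IsUnit (Nat.card H : R) := by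
    intro H
    rw [← IsLocalRing.residue_ne_zero_iff_isUnit, map_natCast]
    exact hcard H
  have hlift : ∀ f : MonoidAlgebra (IsLocalRing.ResidueField R) G, IsIdempotentElem f → ∃ E : MonoidAlgebra R G,
      IsStarProjection E ∧ MonoidAlgebra.mapRingHom G (IsLocalRing.residue R) E = f := by
    intro f hf
    have hfq : f ^ Fintype.card (IsLocalRing.ResidueField R) = f := hf.pow_eq Fintype.card_ne_zero
    have hfg : ∀ (i : ℕ) (g : G), f.coeff (g ^ Fintype.card (IsLocalRing.ResidueField R) ^ i) = f.coeff g := by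
      intro i g
      induction i with
      | zero => simp
      | succ i ih => rw [pow_succ, pow_mul, MonoidAlgebra.coeff_pow_card hqn hfq, ih]
    have hspan := MonoidAlgebra.mem_span_subgroupSum (IsLocalRing.ResidueField R) (x := f) fun g h hgh => by
      obtain ⟨i, rfl⟩ := exists_pow_eq_of_zpowers_eq hqn hq hgh
      rw [hfg]
    obtain ⟨c, hc⟩ := (Submodule.mem_span_range_iff_exists_fun (IsLocalRing.ResidueField R)).mp hspan
    refine exists_isStarProjection_map_eq (k := IsLocalRing.ResidueField R) _ Finset.univ
      (fun H : Subgroup G => MonoidAlgebra.subgroupAverage R H)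
      (fun H => MonoidAlgebra.isStarProjection_subgroupAverage R (hunit H)) f hf
      (fun H => c H * (Nat.card H : (IsLocalRing.ResidueField R))) ?_
    rw [← hc]
    refine Finset.sum_congr rfl fun H _ => ?_
    rw [mul_smul, ← MonoidAlgebra.mapRingHom_subgroupSum R (IsLocalRing.residue R),
      ← MonoidAlgebra.smul_subgroupAverage R (hunit H)]
    simp [Algebra.smul_def]
  intro a
  have : Finite (MonoidAlgebra (IsLocalRing.ResidueField R) G) := Finite.of_equiv (G →₀ (IsLocalRing.ResidueField R)) MonoidAlgebra.coeffEquiv.symm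
  obtain ⟨f, hf, hu⟩ := exists_isIdempotentElem_isUnit_sub
    (MonoidAlgebra.mapRingHom G (IsLocalRing.residue R) a)
  obtain ⟨E, hE, rfl⟩ := hlift f hf
  refine ⟨a - E, E, MonoidAlgebra.isUnit_of_isUnit_mapRingHom_residue _ ?_, hE, by ring⟩
  rwa [map_sub]

/-! ### Necessity: idempotents over ℂ, ℚ and finite fields -/

open ComplexConjugate in
/-- The conjugate of an idempotent of a complex group ring is its image under the involution. -/
theorem MonoidAlgebra.coeff_inv_eq_conj_of_isIdempotentElem {G : Type*} [CommGroup G] [Finite G]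
    {e : MonoidAlgebra ℂ G} (he : IsIdempotentElem e) (g : G) :
    e.coeff g⁻¹ = conj (e.coeff g) := by
  have := Fintype.ofFinite G
  set e' := mapRingHom G (starRingEnd ℂ) (star e) with he'
  -- Positivity: the coefficient at 1 of x times its conjugate adjoint is the sum of the |x_g|². It
  -- is applied to e(1 - e'), e' being the conjugate adjoint of e.
  have key : ∀ x : MonoidAlgebra ℂ G, x * mapRingHom G (starRingEnd ℂ) (star x) = 0 → x = 0 := by
    intro x hx
    have h1 := congrArg (fun y : MonoidAlgebra ℂ G => y.coeff 1) hx
    simp only [coeff_mul_apply_left, coeff_mapRingHom, coeff_star, mul_one, inv_inv, coeff_zero,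
      Finsupp.coe_zero, Pi.zero_apply] at h1
    rw [Finsupp.sum_fintype _ _ (by simp)] at h1
    simp only [Complex.mul_conj] at h1
    have h2 : ∑ i, Complex.normSq (x.coeff i) = 0 := by exact_mod_cast h1
    rw [Finset.sum_eq_zero_iff_of_nonneg fun i _ => Complex.normSq_nonneg _] at h2
    ext g
    simpa using h2 g (Finset.mem_univ g)
  have hinv : mapRingHom G (starRingEnd ℂ) (star e') = e := by
    ext g
    simp [he', coeff_star]
  have hid' : e' * e' = e' := by
    rw [he', ← map_mul, ← star_mul, he]
  have hid : e * e = e := he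
  have h0 := key (e * (1 - e')) (by
    rw [star_mul, map_mul, star_sub, map_sub, star_one, map_one, hinv, ← he']
    linear_combination (e' * e' - e') * hid)
  have h1 : e = e * e' := by linear_combination h0
  have h2 := congrArg (fun x => mapRingHom G (starRingEnd ℂ) (star x)) h1
  simp only [star_mul, map_mul, hinv, ← he'] at h2
  have h3 : e' = e := h2.trans h1.symm
  rw [← h3]
  conv_rhs => rw [h3]
  simp [he', coeff_star]

/-- An idempotent of a rational group ring is invariant under power maps. -/
theorem MonoidAlgebra.coeff_pow_of_isIdempotentElem_rat {G : Type*} [CommGroup G] [Finite G]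
    {e : MonoidAlgebra ℚ G} (he : IsIdempotentElem e) {j : ℕ}
    (hj : j.Coprime (Monoid.exponent G)) (g : G) : e.coeff (g ^ j) = e.coeff g := by
  have hn : NeZero (Monoid.exponent G) := ⟨Monoid.exponent_ne_zero_of_finite⟩
  obtain ⟨⟨N, hN⟩, hb⟩ := IsLocalization.exist_integer_multiples_of_finite (nonZeroDivisors ℤ)
    (fun g : G => e.coeff g)
  have hN0 : N ≠ 0 := nonZeroDivisors.ne_zero hN
  choose c hc using hb
  simp only [zsmul_eq_mul, algebraMap_int_eq, eq_intCast] at hc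
  let C : MonoidAlgebra ℤ G := .ofCoeff (Finsupp.equivFunOnFinite.symm c)
  have hC : mapRingHom G (Int.castRingHom ℚ) C = (N : ℚ) • e := by
    ext g
    simpa [C] using hc g
  have hCC : C * C = (N : MonoidAlgebra ℤ G) * C := by
    apply mapRingHom_injective (f := Int.castRingHom ℚ) Int.cast_injective
    rw [map_mul, map_mul, hC, map_intCast, smul_mul_smul_comm, he, mul_smul, ← zsmul_eq_mul,
      Int.cast_smul_eq_zsmul]
  suffices h : c (g ^ j) = c g by
    have h1 := hc (g ^ j)
    rw [h, hc g] at h1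
    exact (mul_left_cancel₀ (Int.cast_ne_zero.mpr hN0) h1).symm
  -- Dirichlet gives a prime l ≡ j mod exp(G). Modulo l, Frobenius invariance of the reduced
  -- idempotent is invariance under g ↦ g^j. The bound on l keeps N invertible and turns the
  -- congruence of coefficients into an equality.
  obtain ⟨l, hl, hlp, hlj⟩ := Nat.forall_exists_prime_gt_and_eq_mod
    ((ZMod.unitOfCoprime j hj).isUnit) (N.natAbs + (c (g ^ j) - c g).natAbs)
  have := Fact.mk hlp
  rw [ZMod.coe_unitOfCoprime, ZMod.natCast_eq_natCast_iff] at hlj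
  have hgl : g ^ l = g ^ j := by
    rw [pow_eq_pow_iff_modEq]
    exact hlj.of_dvd (Monoid.order_dvd_exponent g)
  have hln : l.Coprime (Monoid.exponent G) := by
    rw [Nat.Coprime, hlj.gcd_eq, hj]
  have hNl : (N : ZMod l) ≠ 0 := by
    rw [Ne, ZMod.intCast_zmod_eq_zero_iff_dvd]
    intro hd
    have := Nat.le_of_dvd (by omega) (Int.natCast_dvd.mp hd)
    omega
  set f : MonoidAlgebra (ZMod l) G := (N : ZMod l)⁻¹ • mapRingHom G (Int.castRingHom (ZMod l)) C
  have hf : IsIdempotentElem f := by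
    have h1 : (N : MonoidAlgebra (ZMod l) G) * mapRingHom G (Int.castRingHom (ZMod l)) C =
        (N : ZMod l) • mapRingHom G (Int.castRingHom (ZMod l)) C := by
      rw [← zsmul_eq_mul, Int.cast_smul_eq_zsmul]
    rw [IsIdempotentElem, smul_mul_smul_comm, ← map_mul, hCC, map_mul, map_intCast, h1, smul_smul,
      mul_assoc, inv_mul_cancel₀ hNl, mul_one]
  have h1 := coeff_pow_card (k := ZMod l) (by rwa [ZMod.card]) (x := f)
    (hf.pow_eq Fintype.card_ne_zero) g
  rw [ZMod.card, hgl] at h1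
  have h2 : ∀ g : G, f.coeff g = (N : ZMod l)⁻¹ * (c g : ZMod l) := fun g => by
    simp [f, C]
  rw [h2, h2] at h1
  have h3 := mul_left_cancel₀ (inv_ne_zero hNl) h1
  rw [← sub_eq_zero, ← Int.cast_sub, ZMod.intCast_zmod_eq_zero_iff_dvd] at h3
  by_contra hne
  have := Nat.le_of_dvd (by omega) (Int.natCast_dvd.mp h3)
  omega

/-- Over a finite field `k`, the fixed points of the `|k|`-power map are spanned by idempotents. -/
theorem eq_sum_smul_isIdempotentElem {k B : Type*} [Field k] [Fintype k] [CommRing B]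
    [Algebra k B] {x : B} (hx : x ^ Fintype.card k = x) :
    ∃ e : k → B, (∀ c, IsIdempotentElem (e c)) ∧ x = ∑ c, c • e c := by
  classical
  have hcard : 1 < Fintype.card k := Fintype.one_lt_card
  -- Lagrange interpolation: 1 - (X - c)^(q-1) is the indicator function of c on k.
  refine ⟨fun c => 1 - (x - algebraMap k B c) ^ (Fintype.card k - 1), fun c => ?_, ?_⟩
  · apply IsIdempotentElem.one_sub
    have h1 : (x - algebraMap k B c) ^ Fintype.card k = x - algebraMap k B c := by
      have := map_sub (FiniteField.frobeniusAlgHom k B) x (algebraMap k B c)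
      simp only [FiniteField.coe_frobeniusAlgHom, hx, ← map_pow, FiniteField.pow_card] at this
      exact this
    obtain ⟨m, hm⟩ := Nat.exists_eq_add_of_lt hcard
    rw [hm, IsIdempotentElem, show 1 + m + 1 - 1 = m + 1 by omega]
    rw [hm] at h1
    calc _ = (x - algebraMap k B c) ^ (1 + m + 1) * (x - algebraMap k B c) ^ m := by ring
      _ = _ := by rw [h1]; ring
  · have hpoly : (Polynomial.X : Polynomial k) = ∑ c : k, Polynomial.C c *
        (1 - (Polynomial.X - Polynomial.C c) ^ (Fintype.card k - 1)) := by
      rw [← sub_eq_zero]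
      refine Polynomial.eq_zero_of_natDegree_lt_card_of_eval_eq_zero _ (f := id)
        Function.injective_id (fun a => ?_) ?_
      · simp only [id, Polynomial.eval_sub, Polynomial.eval_X, Polynomial.eval_finsetSum,
          Polynomial.eval_mul, Polynomial.eval_C, Polynomial.eval_one, Polynomial.eval_pow]
        rw [Finset.sum_eq_single a]
        · rw [sub_self, zero_pow (by omega), sub_zero, mul_one, sub_self]
        · intro c _ hc
          rw [FiniteField.pow_card_sub_one_eq_one _ (sub_ne_zero.mpr hc.symm), sub_self, mul_zero]
        · exact fun h => absurd (Finset.mem_univ a) h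
      · have hdeg : ∀ c : k, (Polynomial.C c *
            (1 - (Polynomial.X - Polynomial.C c) ^ (Fintype.card k - 1))).natDegree ≤
              Fintype.card k - 1 := fun c => by
          refine (Polynomial.natDegree_C_mul_le _ _).trans
            ((Polynomial.natDegree_sub_le _ _).trans (max_le (by simp) ?_))
          simp [Polynomial.natDegree_pow]
        refine lt_of_le_of_lt ((Polynomial.natDegree_sub_le _ _).trans (max_le
          (Polynomial.natDegree_X_le.trans (Nat.le_sub_one_of_lt hcard))
          (Polynomial.natDegree_sum_le_of_forall_le _ _ fun c _ => hdeg c))) (by omega)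
    have := congrArg (Polynomial.aeval x) hpoly
    simpa [Algebra.smul_def] using this

/-- If every idempotent of a group ring over a finite field `k` is invariant under the power maps
of exponent prime to `exp(G)`, then `|k|` generates `(ℤ/exp(G))ˣ`. -/
theorem orderOf_eq_totient_of_coeff_pow {k G : Type*} [Field k] [Fintype k] [CommGroup G]
    [Finite G] (hqn : (Fintype.card k).Coprime (Monoid.exponent G))
    (h : ∀ f : MonoidAlgebra k G, IsIdempotentElem f → ∀ j : ℕ, j.Coprime (Monoid.exponent G) →
      ∀ g, f.coeff (g ^ j) = f.coeff g) :
    orderOf (Fintype.card k : ZMod (Monoid.exponent G)) = (Monoid.exponent G).totient := by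
  classical
  have hn : NeZero (Monoid.exponent G) := ⟨Monoid.exponent_ne_zero_of_finite⟩
  obtain ⟨g, hg⟩ := Monoid.exists_orderOf_eq_exponent (G := G) Monoid.ExponentExists.of_finite
  set q := Fintype.card k
  set u : (ZMod (Monoid.exponent G))ˣ := ZMod.unitOfCoprime q hqn with hu
  have huq : orderOf (q : ZMod (Monoid.exponent G)) = orderOf u := by
    rw [← orderOf_units, hu, ZMod.coe_unitOfCoprime]
  set r := orderOf u with hr
  have hpow : ∀ i j : ℕ, g ^ q ^ i = g ^ j ↔ ((u ^ i : (ZMod (Monoid.exponent G))ˣ) :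
      ZMod (Monoid.exponent G)) = j := by
    intro i j
    rw [pow_eq_pow_iff_modEq, hg, ← ZMod.natCast_eq_natCast_iff, Units.val_pow_eq_pow_val, hu,
      ZMod.coe_unitOfCoprime, Nat.cast_pow]
  have hqr : g ^ q ^ r = g := by
    nth_rw 2 [← pow_one g]
    rw [hpow, hr, pow_orderOf_eq_one]
    simp
  -- The Frobenius orbit sum of an element of order exp(G). It is a combination of idempotents, so
  -- its coefficient is 1 at every g^j with j prime to exp(G); hence each such j is a power of q.
  let y : MonoidAlgebra k G := ∑ i ∈ Finset.range r, .single (g ^ q ^ i) 1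
  have hyq : y ^ q = y := by
    have h1 : y ^ q = ∑ i ∈ Finset.range r, .single (g ^ q ^ (i + 1)) 1 := by
      change FiniteField.frobeniusAlgHom k (MonoidAlgebra k G) y = _
      rw [map_sum]
      refine Finset.sum_congr rfl fun i _ => ?_
      rw [FiniteField.coe_frobeniusAlgHom]
      simp only [MonoidAlgebra.single_pow, one_pow, ← pow_mul]
      rfl
    have h2 := Finset.sum_range_succ (fun i => MonoidAlgebra.single (g ^ q ^ i) (1 : k)) r
    rw [Finset.sum_range_succ', hqr, pow_zero, pow_one] at h2
    rw [h1]
    exact add_right_cancel h2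
  obtain ⟨e, he, hye⟩ := eq_sum_smul_isIdempotentElem hyq
  have hyj : ∀ j : ℕ, j.Coprime (Monoid.exponent G) → y.coeff (g ^ j) = y.coeff g := by
    intro j hj
    rw [hye]
    simp only [MonoidAlgebra.coeff_sum, Finsupp.finsetSum_apply, MonoidAlgebra.coeff_smul_apply]
    exact Finset.sum_congr rfl fun c _ => by rw [h _ (he c) j hj]
  have hcoeff : ∀ x : G, y.coeff x = ∑ i ∈ Finset.range r, if g ^ q ^ i = x then (1 : k) else 0 := by
    intro x
    simp only [y, MonoidAlgebra.coeff_sum, Finsupp.finsetSum_apply,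
      MonoidAlgebra.coeff_single, Finsupp.single_apply]
  have hy1 : y.coeff g = 1 := by
    rw [hcoeff, Finset.sum_eq_single 0]
    · simp
    · intro i hi hi0
      rw [if_neg]
      intro hgi
      nth_rw 2 [← pow_one g] at hgi
      rw [hpow, Nat.cast_one, Units.val_eq_one] at hgi
      exact absurd (Nat.le_of_dvd (Nat.pos_of_ne_zero hi0) (orderOf_dvd_of_pow_eq_one hgi))
        (not_le.mpr (Finset.mem_range.mp hi))
    · intro h0
      exact absurd (Finset.mem_range.mpr (orderOf_pos u)) h0
  have htop : Subgroup.zpowers u = ⊤ := by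
    rw [eq_top_iff]
    intro v _
    have hvj := ZMod.val_coe_unit_coprime v
    have h1 := hyj _ hvj
    rw [hy1, hcoeff] at h1
    obtain ⟨i, -, hi⟩ := Finset.exists_ne_zero_of_sum_ne_zero (h1.trans_ne one_ne_zero)
    have hi' : g ^ q ^ i = g ^ (v : ZMod (Monoid.exponent G)).val := by
      by_contra h0
      exact hi (if_neg h0)
    rw [hpow, ZMod.natCast_zmod_val] at hi'
    exact ⟨i, by simpa using Units.ext hi'⟩
  rw [huq, hr, ← Nat.card_zpowers, htop, Subgroup.card_top, Nat.card_eq_fintype_card,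
    ZMod.card_units_eq_totient]

/-- Decompose any lift of f as u + e. Since f and the image of e are idempotent and that of u is a
unit, u reduces to 1 - 2e, so f is the image of 1 - e. -/
theorem IsStarCleanRing.exists_isStarProjection_lift {R G : Type*} [CommRing R] [CommGroup G]
    {k : Type*} [Field k] {π : R →+* k} (hπ : Function.Surjective π)
    (h : IsStarCleanRing (MonoidAlgebra R G)) {f : MonoidAlgebra k G} (hf : IsIdempotentElem f) :
    ∃ e : MonoidAlgebra R G, IsStarProjection e ∧ MonoidAlgebra.mapRingHom G π e = f := by
  obtain ⟨a, rfl⟩ := MonoidAlgebra.mapRingHom_surjective hπ f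
  obtain ⟨u, e, hu, he, rfl⟩ := h a
  refine ⟨1 - e, he.one_sub, ?_⟩
  set φ := MonoidAlgebra.mapRingHom G π
  have h1 : φ e * φ e = φ e := by rw [← map_mul, he.isIdempotentElem]
  have h2 : (φ u + φ e) * (φ u + φ e) = φ u + φ e := by rw [← map_add]; exact hf
  have h3 : φ u * (φ u + 2 * φ e - 1) = 0 := by linear_combination h2 - h1
  have h4 := (hu.map φ).mul_right_eq_zero.mp h3
  rw [map_sub, map_one, map_add]
  linear_combination -h4

open ComplexConjugate in
/-- If `R` embeds in `ℂ` with only rational real elements, then `*`-cleanness of the group ring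
forces the cardinality of the residue field to generate `(ℤ/exp(G))ˣ`. -/
theorem IsStarCleanRing.orderOf_eq_totient {R G : Type*} [CommRing R] [CommGroup G] [Finite G]
    {k : Type*} [Field k] [Fintype k] {π : R →+* k} (hπ : Function.Surjective π)
    (hqn : (Fintype.card k).Coprime (Monoid.exponent G))
    {ι : R →+* ℂ} (hι : Function.Injective ι) (hreal : ∀ x, conj (ι x) = ι x → ∃ r : ℚ, ι x = r)
    (h : IsStarCleanRing (MonoidAlgebra R G)) :
    orderOf (Fintype.card k : ZMod (Monoid.exponent G)) = (Monoid.exponent G).totient := by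
  refine orderOf_eq_totient_of_coeff_pow hqn fun f hf j hj g => ?_
  obtain ⟨e, he, rfl⟩ := h.exists_isStarProjection_lift hπ hf
  rw [MonoidAlgebra.coeff_mapRingHom, MonoidAlgebra.coeff_mapRingHom]
  congr 1
  apply hι
  have hid := he.isIdempotentElem.map (MonoidAlgebra.mapRingHom G ι)
  have hr : ∀ x : G, ∃ r : ℚ, ι (e.coeff x) = r := fun x => by
    apply hreal
    have h1 := MonoidAlgebra.coeff_inv_eq_conj_of_isIdempotentElem hid x
    rw [MonoidAlgebra.coeff_mapRingHom, MonoidAlgebra.coeff_mapRingHom, ← MonoidAlgebra.coeff_star,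
      he.isSelfAdjoint.star_eq] at h1
    exact h1.symm
  choose c hc using hr
  let E : MonoidAlgebra ℚ G := .ofCoeff (Finsupp.equivFunOnFinite.symm c)
  have hE : MonoidAlgebra.mapRingHom G (Rat.castHom ℂ) E = MonoidAlgebra.mapRingHom G ι e := by
    ext x
    simp [E, hc]
  have hEid : IsIdempotentElem E := by
    apply MonoidAlgebra.mapRingHom_injective (f := Rat.castHom ℂ) (Rat.castHom ℂ).injective
    rw [map_mul, hE, hid]
  have h1 := MonoidAlgebra.coeff_pow_of_isIdempotentElem_rat hEid hj g
  have h2 : c (g ^ j) = c g := h1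
  rw [hc, hc, h2]

open ComplexConjugate in
/-- Over a ring with a real embedding, every idempotent of the group ring is a projection. -/
theorem IsCleanRing.isStarCleanRing {R G : Type*} [CommRing R] [CommGroup G] [Finite G]
    {ι : R →+* ℂ} (hι : Function.Injective ι) (hreal : ∀ x, conj (ι x) = ι x)
    (h : IsCleanRing (MonoidAlgebra R G)) : IsStarCleanRing (MonoidAlgebra R G) := by
  intro a
  obtain ⟨u, e, hu, he, rfl⟩ := h a
  refine ⟨u, e, hu, ⟨he, ?_⟩, rfl⟩
  ext g
  apply hι
  have h1 := MonoidAlgebra.coeff_inv_eq_conj_of_isIdempotentElem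
    (he.map (MonoidAlgebra.mapRingHom G ι)) g
  rw [MonoidAlgebra.coeff_mapRingHom, MonoidAlgebra.coeff_mapRingHom, hreal] at h1
  rw [MonoidAlgebra.coeff_star, h1]

theorem IsStarCleanRing.isCleanRing {A : Type*} [Ring A] [StarRing A] (h : IsStarCleanRing A) :
    IsCleanRing A := fun a => by
  obtain ⟨u, e, hu, he, rfl⟩ := h a
  exact ⟨u, e, hu, he.isIdempotentElem, rfl⟩

/-! ### Primitive roots and negative discriminants -/

theorem orderOf_eq_totient_of_pow {n p r : ℕ} [NeZero n] (hr : r ≠ 0)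
    (hpn : p.Coprime n) (h : orderOf ((p ^ r : ℕ) : ZMod n) = n.totient) :
    orderOf (p : ZMod n) = n.totient ∧ n.totient.Coprime r := by
  have hu : orderOf (p : ZMod n) = orderOf (ZMod.unitOfCoprime p hpn) := by
    rw [← orderOf_units, ZMod.coe_unitOfCoprime]
  have hle : orderOf (p : ZMod n) ∣ n.totient := by
    rw [hu, ← ZMod.card_units_eq_totient]
    exact orderOf_dvd_card
  have hpos : 0 < n.totient := Nat.totient_pos.mpr (NeZero.pos n)
  rw [Nat.cast_pow, orderOf_pow' _ hr] at h
  have h1 : orderOf (p : ZMod n) = n.totient :=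
    Nat.dvd_antisymm hle (h ▸ Nat.div_dvd_of_dvd (Nat.gcd_dvd_left _ _))
  refine ⟨h1, ?_⟩
  rw [h1] at h
  exact (Nat.div_eq_self.mp h).resolve_left hpos.ne'

-- The quadratic character of a negative discriminant is odd. For 4 ∣ D the sign comes from χ₄(b),
-- since b ≡ 3 mod 4; for D ≡ 1 mod 4 reciprocity reduces to (-1/|D|) with |D| ≡ 3 mod 4.
open NumberTheorySymbols in
theorem jacobiSym_eq_neg_one_of_dvd_add_one {D : ℤ} (hD : D < 0) (hD4 : D % 4 = 0 ∨ D % 4 = 1)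
    {b : ℕ} (hb : Odd b) (h : D ∣ (b : ℤ) + 1) : J(D | b) = -1 := by
  obtain ⟨c, hc⟩ : ∃ c : ℕ, D = -(c : ℤ) := ⟨D.natAbs, by omega⟩
  subst hc
  have hcb : c ∣ b + 1 := by
    rw [Int.neg_dvd] at h
    exact_mod_cast h
  rw [jacobiSym.neg _ hb]
  rcases hD4 with h4 | h4
  · obtain ⟨e, rfl⟩ : ∃ e, c = 4 * e := ⟨c / 4, by omega⟩
    have hb4 : b % 4 = 3 := by
      have := (dvd_mul_right 4 e).trans hcb
      omega
    obtain ⟨s, hs⟩ := hcb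
    have hmod : b % (4 * e) = 4 * e - 1 := by
      obtain ⟨s', rfl⟩ : ∃ s', s = s' + 1 := ⟨s - 1, by
        rcases s with _ | s
        · simp at hs
        · rfl⟩
      have : b = (4 * e - 1) + 4 * e * s' := by
        rw [Nat.mul_succ] at hs
        omega
      rw [this, Nat.add_mul_mod_self_left, Nat.mod_eq_of_lt (by omega)]
    have hodd : Odd (4 * e - 1) := Nat.odd_iff.mpr (by omega)
    have h1 : J(((4 * e : ℕ) : ℤ) | 4 * e - 1) = 1 := by
      rw [jacobiSym.mod_left' (a₂ := 1), jacobiSym.one_left]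
      have : ((4 * e : ℕ) : ℤ) = 1 + ((4 * e - 1 : ℕ) : ℤ) := by omega
      rw [this, Int.add_emod_right]
    rw [Nat.cast_mul, jacobiSym.mul_left, Nat.cast_ofNat, jacobiSym.at_four hodd, one_mul] at h1
    rw [Nat.cast_mul, jacobiSym.mul_left, Nat.cast_ofNat, jacobiSym.at_four hb, one_mul,
      jacobiSym.mod_right' _ hb, hmod, h1, ZMod.χ₄_nat_three_mod_four hb4, mul_one]
  · have hc3 : c % 4 = 3 := by omega
    have hcodd : Odd c := Nat.odd_iff.mpr (by omega)
    have h1 : J((b : ℤ) | c) = -1 := by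
      rw [jacobiSym.mod_left' (a₂ := -1), jacobiSym.at_neg_one hcodd,
        ZMod.χ₄_nat_three_mod_four hc3]
      refine Int.modEq_iff_dvd.mpr ?_
      have h2 : -1 - (b : ℤ) = -((b : ℤ) + 1) := by ring
      rw [h2, dvd_neg]
      exact_mod_cast hcb
    rcases Nat.odd_mod_four_iff.mp (Nat.odd_iff.mp hb) with hb4 | hb4
    · rw [jacobiSym.quadratic_reciprocity_one_mod_four' hcodd hb4, h1,
        ZMod.χ₄_nat_one_mod_four hb4, one_mul]
    · rw [jacobiSym.quadratic_reciprocity_three_mod_four hc3 hb4, h1,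
        ZMod.χ₄_nat_three_mod_four hb4]
      norm_num

/-- No power of a prime `p` with `(D/p) = 1` is `-1` modulo a negative discriminant `D`. -/
theorem not_dvd_of_pow_eq_neg_one {D : ℤ} (hD : D < 0) (hD4 : D % 4 = 0 ∨ D % 4 = 1)
    {p : ℕ} [Fact p.Prime] (hp : kroneckerAtPrime D p = 1) {i : ℕ} :
    ¬ D ∣ ((p ^ i : ℕ) : ℤ) + 1 := by
  intro h
  rw [kroneckerAtPrime] at hp
  split_ifs at hp with hp2
  · subst hp2
    have h8 : D % 8 = 1 := by
      have h1 : ∀ x : ZMod 8, ZMod.χ₈ x = 1 → x = 1 ∨ x = 7 := by decide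
      rcases h1 _ hp with h2 | h2
      · have := (ZMod.intCast_eq_intCast_iff D 1 8).mp (by simpa using h2)
        exact this
      · have : D % 8 = 7 % 8 := (ZMod.intCast_eq_intCast_iff D 7 8).mp (by simpa using h2)
        omega
    obtain ⟨c, hc⟩ : ∃ c : ℕ, D = -(c : ℤ) := ⟨D.natAbs, by omega⟩
    subst hc
    have hc8 : c % 8 = 7 := by omega
    have hcodd : Odd c := Nat.odd_iff.mpr (by omega)
    -- Contradiction for p = 2: 2^i ≡ -1 mod c gives symbol (-1/c) = -1, but (2/c) = 1 because c ≡ 7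
    -- mod 8.
    have h1 : jacobiSym ((2 ^ i : ℕ) : ℤ) c = -1 := by
      rw [jacobiSym.mod_left' (a₂ := -1), jacobiSym.at_neg_one hcodd,
        ZMod.χ₄_nat_three_mod_four (by omega)]
      refine Int.modEq_iff_dvd.mpr ?_
      have h2 : -1 - ((2 ^ i : ℕ) : ℤ) = -(((2 ^ i : ℕ) : ℤ) + 1) := by ring
      rw [h2, dvd_neg]
      exact (Int.neg_dvd).mp h
    rw [Nat.cast_pow, Nat.cast_ofNat, jacobiSym.pow_left, jacobiSym.at_two hcodd,
      ZMod.χ₈_nat_mod_eight, hc8] at h1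
    have h7 : ZMod.χ₈ ((7 : ℕ) : ZMod 8) = 1 := by decide
    rw [h7, one_pow] at h1
    norm_num at h1
  · have hodd : Odd (p ^ i) := ((Fact.out : p.Prime).odd_of_ne_two hp2).pow
    have h1 := jacobiSym_eq_neg_one_of_dvd_add_one hD hD4 hodd h
    rw [jacobiSym.pow_right, ← jacobiSym.legendreSym.to_jacobiSym, hp, one_pow] at h1
    norm_num at h1

/-- A negative discriminant does not divide a modulus for which a noninert prime is a primitive
root. -/
theorem not_dvd_of_orderOf_eq_totient {D : ℤ} (hD : D < 0) (hD4 : D % 4 = 0 ∨ D % 4 = 1)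
    {p n : ℕ} [Fact p.Prime] [NeZero n] (hpn : p.Coprime n)
    (hp : kroneckerAtPrime D p = 1 ∨ kroneckerAtPrime D p = 0)
    (h : orderOf (p : ZMod n) = n.totient) : ¬ D ∣ (n : ℤ) := by
  intro hdvd
  have hp' : kroneckerAtPrime D p = 1 := by
    refine hp.resolve_right fun h0 => ?_
    have hpD : (p : ℤ) ∣ D := by
      rw [kroneckerAtPrime] at h0
      split_ifs at h0 with hp2
      · subst hp2
        have h1 : ∀ x : ZMod 8, ZMod.χ₈ x = 0 → x = 0 ∨ x = 2 ∨ x = 4 ∨ x = 6 := by decide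
        have h2 : ∀ y : ℤ, (D : ZMod 8) = (y : ZMod 8) → D % 8 = y % 8 := fun y hy =>
          (ZMod.intCast_eq_intCast_iff D y 8).mp hy
        rcases h1 _ h0 with h3 | h3 | h3 | h3
        · have := h2 0 (by simpa using h3); omega
        · have := h2 2 (by simpa using h3); omega
        · have := h2 4 (by simpa using h3); omega
        · have := h2 6 (by simpa using h3); omega
      · rwa [legendreSym.eq_zero_iff, ZMod.intCast_zmod_eq_zero_iff_dvd] at h0
    have h1 : p ∣ n := by exact_mod_cast hpD.trans hdvd
    exact (Fact.out : p.Prime).one_lt.ne' (Nat.eq_one_of_dvd_coprimes hpn dvd_rfl h1)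
  -- A primitive root has -1 among its powers modulo n, hence modulo D if D divides n.
  obtain ⟨i, hi⟩ := ZMod.mem_powers_of_orderOf_eq_totient hpn h (-1)
  refine not_dvd_of_pow_eq_neg_one hD hD4 hp' (i := i) (hdvd.trans ?_)
  rw [← ZMod.intCast_zmod_eq_zero_iff_dvd]
  push_cast
  rw [hi]
  simp

/-- For `D = t² + 4m`, the Kronecker symbol `(D/p)` detects roots of `X² - tX - m` modulo `p`. -/
theorem kroneckerAtPrime_eq_one_or_zero_iff (t m : ℤ) (p : ℕ) [Fact p.Prime] :
    (kroneckerAtPrime (t ^ 2 + 4 * m) p = 1 ∨ kroneckerAtPrime (t ^ 2 + 4 * m) p = 0) ↔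
      ∃ r : ℤ, (p : ℤ) ∣ r ^ 2 - t * r - m := by
  rw [kroneckerAtPrime]
  split_ifs with hp2
  · subst hp2
    -- Evenness is encoded as 4x = 0 in ℤ/8, so that both sides are decided in the same finite ring.
    have h1 : ∀ t m : ZMod 8, (ZMod.χ₈ (t ^ 2 + 4 * m) = 1 ∨ ZMod.χ₈ (t ^ 2 + 4 * m) = 0) ↔
      ∃ r : ZMod 8, 4 * (r ^ 2 - t * r - m) = 0 := by decide
    push_cast
    rw [h1]
    constructor
    · rintro ⟨r, hr⟩
      obtain ⟨r, rfl⟩ := ZMod.intCast_surjective r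
      refine ⟨r, ?_⟩
      have h2 : ((4 * (r ^ 2 - t * r - m) : ℤ) : ZMod 8) = 0 := by push_cast; exact hr
      rw [ZMod.intCast_zmod_eq_zero_iff_dvd] at h2
      push_cast at h2 ⊢
      omega
    · rintro ⟨r, s, hs⟩
      refine ⟨r, ?_⟩
      have h2 : ((4 * (r ^ 2 - t * r - m) : ℤ) : ZMod 8) = 0 := by
        rw [ZMod.intCast_zmod_eq_zero_iff_dvd, hs]
        exact ⟨s, by push_cast; ring⟩
      push_cast at h2
      exact h2
  · have h2 : (2 : ZMod p) ≠ 0 := by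
      intro h0
      have : p ∣ 2 := (ZMod.natCast_eq_zero_iff 2 p).mp (by exact_mod_cast h0)
      exact hp2 ((Nat.prime_dvd_prime_iff_eq Fact.out Nat.prime_two).mp this)
    constructor
    · intro h
      have hsq : IsSquare (((t ^ 2 + 4 * m : ℤ)) : ZMod p) := by
        rcases h with h | h
        · exact ((legendreSym.eq_one_iff p (fun h0 => by
            rw [(legendreSym.eq_zero_iff p _).mpr h0] at h; norm_num at h)).mp h)
        · rw [(legendreSym.eq_zero_iff p _).mp h]; exact IsSquare.zero
      obtain ⟨s, hs⟩ := hsq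
      obtain ⟨r, hr⟩ := ZMod.intCast_surjective ((t + s) / 2 : ZMod p)
      refine ⟨r, ?_⟩
      rw [← ZMod.intCast_zmod_eq_zero_iff_dvd]
      push_cast at hs ⊢
      rw [hr]
      field_simp
      linear_combination -hs
    · rintro ⟨r, hr⟩
      rw [← ZMod.intCast_zmod_eq_zero_iff_dvd] at hr
      by_cases h0 : ((t ^ 2 + 4 * m : ℤ) : ZMod p) = 0
      · exact Or.inr ((legendreSym.eq_zero_iff p _).mpr h0)
      · refine Or.inl ((legendreSym.eq_one_iff p h0).mpr ⟨2 * r - t, ?_⟩)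
        push_cast at hr ⊢
        linear_combination -4 * hr

/-! ### Discriminant and integers of a quadratic field -/

theorem Algebra.trace_of_sq_eq {A B : Type*} [CommRing A] [CommRing B] [Algebra A B]
    (b : Module.Basis (Fin 2) A B) (h0 : b 0 = 1) {t m : A}
    (h1 : b 1 ^ 2 = t • b 1 + m • (1 : B)) : Algebra.trace A B (b 1) = t := by
  rw [Algebra.trace_eq_matrix_trace b, Matrix.trace_fin_two, Algebra.leftMulMatrix_eq_repr_mul,
    Algebra.leftMulMatrix_eq_repr_mul, h0, mul_one, ← sq, h1, ← h0]
  simp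

theorem Algebra.discr_of_sq_eq {A B : Type*} [CommRing A] [Nontrivial A] [CommRing B] [Algebra A B]
    (b : Module.Basis (Fin 2) A B) (h0 : b 0 = 1) {t m : A}
    (h1 : b 1 ^ 2 = t • b 1 + m • (1 : B)) : Algebra.discr A b = t ^ 2 + 4 * m := by
  have ht := Algebra.trace_of_sq_eq b h0 h1
  have hone : Algebra.trace A B 1 = 2 := by
    have := Module.Free.of_basis b
    rw [← map_one (algebraMap A B), Algebra.trace_algebraMap, Module.finrank_eq_card_basis b]
    simp
  rw [Algebra.discr_def, Matrix.det_fin_two]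
  simp only [Algebra.traceMatrix_apply, Algebra.traceForm_apply, h0, mul_one, one_mul, ht, hone]
  rw [← sq, h1, map_add, map_smul, map_smul, ht, hone]
  simp only [smul_eq_mul]
  ring

/-- The square of the denominator of r must divide d. -/
theorem exists_int_eq_of_squarefree {d : ℤ} (hd : Squarefree d) {r : ℚ}
    (h : ∃ s : ℤ, d * r ^ 2 = s) : ∃ z : ℤ, r = z := by
  obtain ⟨s, hs⟩ := h
  have hden : (r.den : ℤ) ≠ 0 := by exact_mod_cast r.den_nz
  have h1 : d * r.num ^ 2 = s * (r.den : ℤ) ^ 2 := by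
    have h2 : (r : ℚ) * r.den = r.num := Rat.mul_den_eq_num r
    have : (d : ℚ) * r.num ^ 2 = s * (r.den : ℚ) ^ 2 := by
      rw [← h2, ← hs]; ring
    exact_mod_cast this
  have hcop : IsCoprime ((r.den : ℤ) ^ 2) (r.num ^ 2) := by
    apply IsCoprime.pow
    rw [Int.isCoprime_iff_gcd_eq_one, Int.gcd_comm]
    exact r.reduced
  have h3 : (r.den : ℤ) * r.den ∣ d := by
    rw [← sq]
    exact hcop.dvd_of_dvd_mul_right ⟨s, by rw [h1, mul_comm]⟩
  have h4 : r.den = 1 := by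
    have := Int.isUnit_iff_natAbs_eq.mp (hd _ h3)
    simpa using this
  exact ⟨r.num, ((Rat.den_eq_one_iff r).mp h4).symm⟩

section Quadratic

variable {d : ℤ} (hd : Squarefree d) (hd1 : d ≠ 1) {K : Type*} [Field K] [NumberField K] {α : K}
  (hα : α ^ 2 = (d : K)) (hK : IntermediateField.adjoin ℚ {α} = ⊤)
include hα

include hK in
theorem exists_rat_add_rat_mul_eq (x : K) : ∃ a b : ℚ, x = a + b * α := by
  have hx : x ∈ IntermediateField.adjoin ℚ {α} := hK ▸ IntermediateField.mem_top
  rw [← IntermediateField.mem_toSubalgebra,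
    IntermediateField.adjoin_simple_toSubalgebra_of_isAlgebraic (Algebra.IsAlgebraic.isAlgebraic α)]
    at hx
  induction hx using Algebra.adjoin_induction with
  | mem x hx => exact ⟨0, 1, by simpa using hx⟩
  | algebraMap r => exact ⟨r, 0, by simp⟩
  | add x y _ _ hx hy =>
    obtain ⟨a, b, rfl⟩ := hx
    obtain ⟨a', b', rfl⟩ := hy
    exact ⟨a + a', b + b', by push_cast; ring⟩
  | mul x y _ _ hx hy =>
    obtain ⟨a, b, rfl⟩ := hx
    obtain ⟨a', b', rfl⟩ := hy
    refine ⟨a * a' + b * b' * d, a * b' + a' * b, ?_⟩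
    push_cast
    linear_combination (b * b' : K) * hα

include hd hd1 in
theorem rat_add_rat_mul_eq_zero {a b : ℚ} (h : (a : K) + b * α = 0) : a = 0 ∧ b = 0 := by
  have hb : b = 0 := by
    by_contra hb
    have hbK : (b : K) ≠ 0 := Rat.cast_ne_zero.mpr hb
    have h1 : α = ((-a / b : ℚ) : K) := by
      push_cast
      field_simp
      linear_combination h
    have h2 : (d : ℚ) = (-a / b) ^ 2 := by
      rw [h1] at hα
      exact_mod_cast hα.symm
    obtain ⟨z, hz⟩ := exists_int_eq_of_squarefree (d := 1) squarefree_one (r := -a / b)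
      ⟨d, by rw [h2]; simp⟩
    rw [hz] at h2
    have h3 : d = z * z := by rw [← sq]; exact_mod_cast h2
    have h4 := hd z ⟨1, by rw [mul_one]; exact h3⟩
    rcases Int.isUnit_iff.mp h4 with h5 | h5 <;> rw [h5] at h3 <;> exact hd1 (by simpa using h3)
  refine ⟨?_, hb⟩
  rw [hb] at h
  simpa using h

-- The trace 2a and the norm a² - db² are integers; then d(2b)² is an integer, and squarefreeness
-- makes 2b one.
include hd hd1 hK in
theorem exists_int_of_isIntegral {a b : ℚ} (h : IsIntegral ℤ ((a : K) + b * α)) :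
    ∃ A B : ℤ, 2 * a = A ∧ 2 * b = B ∧ 4 ∣ A ^ 2 - d * B ^ 2 := by
  have hli : LinearIndependent ℚ ![(1 : K), α] := by
    rw [LinearIndependent.pair_iff]
    intro s t hst
    refine rat_add_rat_mul_eq_zero hd hd1 hα ?_
    simpa [Algebra.smul_def] using hst
  let e : Module.Basis (Fin 2) ℚ K := Module.Basis.mk hli (by
    rintro x -
    obtain ⟨a, b, rfl⟩ := exists_rat_add_rat_mul_eq hα hK x
    rw [Matrix.range_cons_cons_empty, Submodule.mem_span_pair]
    exact ⟨a, b, by simp [Algebra.smul_def]⟩)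
  have he0 : e 0 = 1 := by simp [e]
  have he1 : e 1 = α := by simp [e]
  have htr : Algebra.trace ℚ K α = 0 := by
    rw [← he1]
    refine Algebra.trace_of_sq_eq e he0 (m := d) ?_
    rw [he1, hα]
    simp [Algebra.smul_def]
  have htrace : Algebra.trace ℚ K ((a : K) + b * α) = 2 * a := by
    have h1 : (a : K) + b * α = algebraMap ℚ K a + b • α := by simp [Algebra.smul_def]
    rw [h1, map_add, map_smul, htr, Algebra.trace_algebraMap, Module.finrank_eq_card_basis e]
    simp
  have hA : IsIntegral ℤ (2 * a : ℚ) := htrace ▸ Algebra.isIntegral_trace h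
  obtain ⟨A, hA⟩ := IsIntegrallyClosed.isIntegral_iff.mp hA
  have hN : IsIntegral ℤ (algebraMap ℚ K (a ^ 2 - d * b ^ 2)) := by
    have h1 : algebraMap ℚ K (a ^ 2 - d * b ^ 2) =
        algebraMap ℤ K A * (a + b * α) - (a + b * α) ^ 2 := by
      have h2 : (A : K) = 2 * a := by
        have : ((A : ℚ) : K) = ((2 * a : ℚ) : K) := congrArg _ hA
        simpa using this
      simp only [eq_ratCast, eq_intCast, h2]
      push_cast
      linear_combination (b : K) ^ 2 * hα
    rw [h1]
    exact (isIntegral_algebraMap.mul h).sub (h.pow 2)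
  rw [isIntegral_algebraMap_iff (algebraMap ℚ K).injective] at hN
  obtain ⟨N, hN⟩ := IsIntegrallyClosed.isIntegral_iff.mp hN
  simp only [eq_intCast] at hA hN
  obtain ⟨B, hB⟩ := exists_int_eq_of_squarefree hd (r := 2 * b)
    ⟨A ^ 2 - 4 * N, by push_cast; rw [hA, hN]; ring⟩
  refine ⟨A, B, hA.symm, hB, N, ?_⟩
  have : (A : ℚ) ^ 2 - d * B ^ 2 = 4 * N := by rw [hA, hN, ← hB]; ring
  exact_mod_cast this

open NumberField in
include hd hd1 hK in
/-- The ring of integers of a quadratic field is generated by a root of an integral quadratic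
polynomial whose discriminant is that of the field. -/
theorem exists_generator_ringOfIntegers : ∃ (ω : 𝓞 K) (t m : ℤ), ω ^ 2 = t * ω + m ∧
    (∀ x : 𝓞 K, ∃ a b : ℤ, x = a + b * ω) ∧ discr K = t ^ 2 + 4 * m ∧
    (t ^ 2 + 4 * m = d ∨ t ^ 2 + 4 * m = 4 * d) := by
  have hinj : Function.Injective (algebraMap (𝓞 K) K) := RingOfIntegers.coe_injective
  have hrat : ∀ x : 𝓞 K, ∃ a b : ℚ, algebraMap (𝓞 K) K x = a + b * α ∧
      ∃ A B : ℤ, 2 * a = A ∧ 2 * b = B ∧ 4 ∣ A ^ 2 - d * B ^ 2 := fun x => by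
    obtain ⟨a, b, hx⟩ := exists_rat_add_rat_mul_eq hα hK (algebraMap (𝓞 K) K x)
    refine ⟨a, b, hx, exists_int_of_isIntegral hd hd1 hα hK ?_⟩
    rw [← hx]
    exact RingOfIntegers.isIntegral_coe x
  obtain ⟨ω, t, m, hω, hgen, hdisc, hlin⟩ : ∃ (ω : 𝓞 K) (t m : ℤ), ω ^ 2 = t * ω + m ∧
      (∀ x : 𝓞 K, ∃ a b : ℤ, x = a + b * ω) ∧
      (t ^ 2 + 4 * m = d ∨ t ^ 2 + 4 * m = 4 * d) ∧
      ∃ u v : ℚ, v ≠ 0 ∧ algebraMap (𝓞 K) K ω = u + v * α := by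
    by_cases h4 : d % 4 = 1
    · obtain ⟨m, rfl⟩ : ∃ m, d = 1 + 4 * m := ⟨d / 4, by omega⟩
      have hint : ((1 + α) / 2) ^ 2 = (1 + α) / 2 + (m : K) := by
        push_cast at hα
        linear_combination hα / 4
      obtain ⟨ω, hω⟩ : ∃ ω : 𝓞 K, algebraMap (𝓞 K) K ω = (1 + α) / 2 := by
        refine ⟨⟨(1 + α) / 2, .X ^ 2 - .X - .C m, by monicity!, ?_⟩, rfl⟩
        simp only [Polynomial.eval₂_sub, Polynomial.eval₂_pow, Polynomial.eval₂_X,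
          Polynomial.eval₂_C, hint, algebraMap_int_eq, Int.coe_castRingHom]
        ring
      refine ⟨ω, 1, m, ?_, fun x => ?_, Or.inl (by ring), 1 / 2, 1 / 2, by norm_num, ?_⟩
      · apply hinj
        simp [hω, hint]
      · obtain ⟨a, b, hx, A, B, hA, hB, hAB⟩ := hrat x
        have hpar : 2 ∣ A - B := by
          rcases Int.even_or_odd' A with ⟨A', rfl | rfl⟩ <;>
          rcases Int.even_or_odd' B with ⟨B', rfl | rfl⟩ <;> ring_nf at hAB <;> omega
        obtain ⟨c, hc⟩ := hpar
        refine ⟨c, B, ?_⟩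
        apply hinj
        have hA' : (2 * a : K) = A := by exact_mod_cast congrArg (Rat.cast : ℚ → K) hA
        have hB' : (2 * b : K) = B := by exact_mod_cast congrArg (Rat.cast : ℚ → K) hB
        have hc' : (A : K) - B = 2 * c := by exact_mod_cast congrArg (Int.cast : ℤ → K) hc
        rw [hx, map_add, map_mul, map_intCast, map_intCast, hω]
        linear_combination hA' / 2 + hB' * α / 2 + hc' / 2
      · rw [hω]
        push_cast
        ring
    · obtain ⟨ω, hω⟩ : ∃ ω : 𝓞 K, algebraMap (𝓞 K) K ω = α := by
        refine ⟨⟨α, .X ^ 2 - .C d, by monicity!, ?_⟩, rfl⟩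
        simp only [Polynomial.eval₂_sub, Polynomial.eval₂_pow, Polynomial.eval₂_X,
          Polynomial.eval₂_C, hα, algebraMap_int_eq, Int.coe_castRingHom, sub_self]
      refine ⟨ω, 0, d, ?_, fun x => ?_, Or.inr (by ring), 0, 1, one_ne_zero, ?_⟩
      · apply hinj
        simp [hω, hα]
      · obtain ⟨a, b, hx, A, B, hA, hB, hAB⟩ := hrat x
        have hd4 : d % 4 ≠ 0 := fun h => by
          have := hd 2 (by omega)
          rw [Int.isUnit_iff] at this
          omega
        have hAB2 : 2 ∣ A ∧ 2 ∣ B := by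
          rcases Int.even_or_odd' A with ⟨A', rfl | rfl⟩ <;>
          rcases Int.even_or_odd' B with ⟨B', rfl | rfl⟩ <;> ring_nf at hAB <;> omega
        obtain ⟨⟨a', rfl⟩, ⟨b', rfl⟩⟩ := hAB2
        push_cast at hA hB
        have hA' : a = a' := by linarith
        have hB' : b = b' := by linarith
        refine ⟨a', b', ?_⟩
        apply hinj
        rw [hx, hA', hB', map_add, map_mul, map_intCast, map_intCast, hω]
        push_cast
        ring
      · simp [hω]
  refine ⟨ω, t, m, hω, hgen, ?_, hdisc⟩
  obtain ⟨u, v, hv, huv⟩ := hlin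
  have hli : LinearIndependent ℤ ![(1 : 𝓞 K), ω] := by
    rw [LinearIndependent.pair_iff]
    intro a b hab
    have h1 := congrArg (algebraMap (𝓞 K) K) hab
    have h2 := rat_add_rat_mul_eq_zero hd hd1 hα (a := a + b * u) (b := b * v) (by
      simp at h1
      push_cast
      rw [huv] at h1
      linear_combination h1)
    have hb : b = 0 := by simpa [hv] using h2.2
    refine ⟨?_, hb⟩
    have := h2.1
    rw [hb] at this
    simpa using this
  let e : Module.Basis (Fin 2) ℤ (𝓞 K) := Module.Basis.mk hli (by
    rintro x -
    obtain ⟨a, b, rfl⟩ := hgen x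
    rw [Matrix.range_cons_cons_empty, Submodule.mem_span_pair]
    exact ⟨a, b, by simp⟩)
  rw [← NumberField.discr_eq_discr K e]
  have he1 : e 1 = ω := by simp [e]
  refine Algebra.discr_of_sq_eq e (by simp [e]) ?_
  rw [he1, hω]
  simp

end Quadratic

/-! ### Residue fields of a quadratic order -/

section QuadraticResidueField

variable {O k : Type*} [CommRing O] {ω : O} {t m : ℤ} (hω : ω ^ 2 = t * ω + m)
  (hgen : ∀ x : O, ∃ a b : ℤ, x = a + b * ω) [Field k] {π : O →+* k}
  (hπ : Function.Surjective π) {p : ℕ} [Fact p.Prime] [CharP k p]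
include hgen hπ

variable (p ω) in
theorem surjective_zmod_prod_zmod : Function.Surjective fun x : ZMod p × ZMod p =>
    ZMod.castHom dvd_rfl k x.1 + ZMod.castHom dvd_rfl k x.2 * π ω := fun y => by
  obtain ⟨x, rfl⟩ := hπ y
  obtain ⟨a, b, rfl⟩ := hgen x
  exact ⟨(a, b), by simp⟩

theorem finite_of_quadratic_generator (p : ℕ) [Fact p.Prime] [CharP k p] : Finite k :=
  Finite.of_surjective _ (surjective_zmod_prod_zmod ω hgen hπ p)

theorem card_le_sq_of_quadratic_generator [Fintype k] : Fintype.card k ≤ p ^ 2 := by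
  have h := Fintype.card_le_of_surjective _ (surjective_zmod_prod_zmod ω hgen hπ p)
  rwa [Fintype.card_prod, ZMod.card, ← sq] at h

include hω in
theorem card_eq_prime_iff_of_quadratic_generator [Fintype k] :
    Fintype.card k = p ↔ ∃ r : ℤ, (p : ℤ) ∣ r ^ 2 - t * r - m := by
  have hω' : π ω ^ 2 = t * π ω + m := by rw [← map_pow, hω]; simp
  have hinj : Function.Injective (ZMod.castHom (dvd_refl p) k) := RingHom.injective _
  constructor
  · intro h
    have hbij : Function.Bijective (ZMod.castHom (dvd_refl p) k) :=
      (Fintype.bijective_iff_injective_and_card _).mpr ⟨hinj, by rw [ZMod.card, h]⟩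
    obtain ⟨r', hr'⟩ := hbij.2 (π ω)
    obtain ⟨r, rfl⟩ := ZMod.intCast_surjective r'
    rw [map_intCast] at hr'
    refine ⟨r, ?_⟩
    rw [← CharP.intCast_eq_zero_iff k p]
    push_cast
    rw [hr', hω']
    ring
  · rintro ⟨r, hr⟩
    rw [← CharP.intCast_eq_zero_iff k p] at hr
    push_cast at hr
    obtain ⟨s, hs⟩ : ∃ s : ℤ, π ω = s := by
      -- A root r makes the quadratic polynomial split with roots r and t - r, so ω reduces into the
      -- prime field.
      have h1 : (π ω - r) * (π ω - (t - r)) = 0 := by linear_combination hω' - hr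
      rcases mul_eq_zero.mp h1 with h2 | h2
      · exact ⟨r, sub_eq_zero.mp h2⟩
      · exact ⟨t - r, by push_cast; exact sub_eq_zero.mp h2⟩
    have hsurj : Function.Surjective (ZMod.castHom (dvd_refl p) k) := fun y => by
      obtain ⟨x, rfl⟩ := hπ y
      obtain ⟨a, b, rfl⟩ := hgen x
      exact ⟨a + b * s, by simp [hs]⟩
    rw [← Fintype.card_of_bijective ⟨hinj, hsurj⟩, ZMod.card]

end QuadraticResidueField

/-! ### Complex embeddings and conjugation -/

section QuadraticEmbedding

open ComplexConjugate

theorem Complex.conj_eq_self_of_sq_eq_pos {z : ℂ} {d : ℤ} (hd : 0 < d) (hz : z ^ 2 = d) :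
    conj z = z := by
  rw [Complex.conj_eq_iff_im]
  have hre := congrArg Complex.re hz
  have him := congrArg Complex.im hz
  simp only [sq, Complex.mul_re, Complex.mul_im, Complex.intCast_re, Complex.intCast_im] at hre him
  have hd' : (0 : ℝ) < d := by exact_mod_cast hd
  by_contra h
  have h1 : z.re = 0 := (mul_eq_zero.mp (show z.re * z.im = 0 by linarith)).resolve_right h
  rw [h1] at hre
  nlinarith [sq_nonneg z.im]

theorem Complex.conj_eq_neg_of_sq_eq_neg {z : ℂ} {d : ℤ} (hd : d < 0) (hz : z ^ 2 = d) :
    conj z = -z := by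
  have hre := congrArg Complex.re hz
  have him := congrArg Complex.im hz
  simp only [sq, Complex.mul_re, Complex.mul_im, Complex.intCast_re, Complex.intCast_im] at hre him
  have hd' : (d : ℝ) < 0 := by exact_mod_cast hd
  have h1 : z.re = 0 := by
    by_contra h
    have h2 : z.im = 0 := (mul_eq_zero.mp (show z.re * z.im = 0 by linarith)).resolve_left h
    rw [h2] at hre
    nlinarith [sq_nonneg z.re]
  apply Complex.ext <;> simp [h1]

variable {d : ℤ} {K : Type*} [Field K] [NumberField K] {α : K}
  (hα : α ^ 2 = (d : K)) (hK : IntermediateField.adjoin ℚ {α} = ⊤) (φ : K →+* ℂ)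
include hα hK

theorem conj_eq_self_of_real_quadratic (hd : 0 < d) (x : K) : conj (φ x) = φ x := by
  obtain ⟨a, b, rfl⟩ := exists_rat_add_rat_mul_eq hα hK x
  have h := Complex.conj_eq_self_of_sq_eq_pos hd (z := φ α) (by rw [← map_pow, hα, map_intCast])
  simp [h]

theorem exists_rat_of_imaginary_quadratic (hd : d < 0) (x : K) (hx : conj (φ x) = φ x) :
    ∃ r : ℚ, φ x = r := by
  obtain ⟨a, b, rfl⟩ := exists_rat_add_rat_mul_eq hα hK x
  have h := Complex.conj_eq_neg_of_sq_eq_neg hd (z := φ α) (by rw [← map_pow, hα, map_intCast])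
  simp only [map_add, map_mul, map_ratCast, h] at hx
  refine ⟨a, ?_⟩
  simp only [map_add, map_mul, map_ratCast]
  linear_combination -hx / 2

end QuadraticEmbedding

-- The conjugation statements above concern K; this transfers them to the localization, whose image
-- stays inside φ(K).
open NumberField in
theorem exists_injective_localization_ringHom {K L : Type*} [Field K] [NumberField K] [Field L]
    (φ : K →+* L) (𝔭 : Ideal (𝓞 K)) [𝔭.IsPrime] :
    ∃ ι : Localization.AtPrime 𝔭 →+* L, Function.Injective ι ∧ ∀ x, ∃ y, ι x = φ y := by
  have hinj : Function.Injective (φ.comp (algebraMap (𝓞 K) K)) :=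
    φ.injective.comp RingOfIntegers.coe_injective
  have hunit : ∀ s : 𝔭.primeCompl, IsUnit (φ.comp (algebraMap (𝓞 K) K) s) := fun s => by
    rw [isUnit_iff_ne_zero, Ne, map_eq_zero_iff _ hinj]
    rintro h
    exact s.2 (h ▸ 𝔭.zero_mem)
  refine ⟨IsLocalization.lift (S := Localization.AtPrime 𝔭) hunit, ?_, fun x => ?_⟩
  · rw [IsLocalization.lift_injective_iff]
    intro x y
    rw [hinj.eq_iff, (IsLocalization.injective (Localization.AtPrime 𝔭)
      𝔭.primeCompl_le_nonZeroDivisors).eq_iff]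
  · obtain ⟨a, s, rfl⟩ := IsLocalization.exists_mk'_eq 𝔭.primeCompl x
    refine ⟨algebraMap (𝓞 K) K a / algebraMap (𝓞 K) K s, ?_⟩
    rw [IsLocalization.lift_mk'_spec, map_div₀]
    have := (hunit s).ne_zero
    simp only [RingHom.comp_apply] at this ⊢
    field_simp

theorem theorem4p6 (d : ℤ) (hd : Squarefree d) (hd1 : d ≠ 1)
    (K : Type*) [Field K] [NumberField K] (α : K) (hα : α ^ 2 = (d : K))
    (hK : IntermediateField.adjoin ℚ {α} = ⊤)
    (𝔭 : Ideal (NumberField.RingOfIntegers K)) [𝔭.IsPrime] (h𝔭 : 𝔭 ≠ ⊥)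
    (p : ℕ) [Fact p.Prime]
    (hp : 𝔭.comap (algebraMap ℤ (NumberField.RingOfIntegers K)) = Ideal.span {(p : ℤ)})
    (G : Type*) [CommGroup G] [Finite G] (hpG : ¬ p ∣ Monoid.exponent G) :
    (3 ≤ Monoid.exponent G →
      (0 < d →
        (IsStarCleanRing (MonoidAlgebra (Localization.AtPrime 𝔭) G) ↔
          IsCleanRing (MonoidAlgebra (Localization.AtPrime 𝔭) G))) ∧
      (d < 0 →
        (IsStarCleanRing (MonoidAlgebra (Localization.AtPrime 𝔭) G) ↔
          ¬ NumberField.discr K ∣ (Monoid.exponent G : ℤ) ∧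
          orderOf (p : ZMod (Monoid.exponent G)) = Nat.totient (Monoid.exponent G) ∧
          (kroneckerAtPrime (NumberField.discr K) p = 1 ∨
            kroneckerAtPrime (NumberField.discr K) p = 0)))) ∧
    (Monoid.exponent G ≤ 2 →
      IsStarCleanRing (MonoidAlgebra (Localization.AtPrime 𝔭) G)) := by
  have hmax : 𝔭.IsMaximal := Ideal.IsPrime.isMaximal ‹_› h𝔭
  have hn : NeZero (Monoid.exponent G) := ⟨Monoid.exponent_ne_zero_of_finite⟩
  obtain ⟨ω, t, m, hω, hgen, hdiscr, hD⟩ := exists_generator_ringOfIntegers hd hd1 hα hK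
  have hπ : Function.Surjective (algebraMap (NumberField.RingOfIntegers K) 𝔭.ResidueField) :=
    𝔭.algebraMap_residueField_surjective
  have hchar : CharP 𝔭.ResidueField p := by
    rw [CharP.charP_iff_prime_eq_zero Fact.out]
    have h1 : (p : ℤ) ∈ 𝔭.comap (algebraMap ℤ (NumberField.RingOfIntegers K)) :=
      hp ▸ Ideal.mem_span_singleton_self _
    rw [Ideal.mem_comap, ← Ideal.algebraMap_residueField_eq_zero] at h1
    simpa using h1
  have hfin : Finite 𝔭.ResidueField := finite_of_quadratic_generator hgen hπ p
  have : Fintype 𝔭.ResidueField := Fintype.ofFinite _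
  obtain ⟨r, -, hcard⟩ := FiniteField.card 𝔭.ResidueField p
  have hpn : p.Coprime (Monoid.exponent G) :=
    ((Fact.out : p.Prime).coprime_iff_not_dvd).mpr hpG
  have hqn : (Fintype.card 𝔭.ResidueField).Coprime (Monoid.exponent G) := by
    rw [hcard]
    exact hpn.pow_left _
  have hqp := card_eq_prime_iff_of_quadratic_generator hω hgen hπ (p := p)
  rw [← kroneckerAtPrime_eq_one_or_zero_iff, ← hdiscr] at hqp
  obtain ⟨φ⟩ : Nonempty (K →+* ℂ) := inferInstance
  obtain ⟨ι, hι, hιφ⟩ := exists_injective_localization_ringHom φ 𝔭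
  refine ⟨fun hn3 => ⟨fun hd0 => ⟨fun h => h.isCleanRing, ?_⟩, fun hd0 => ⟨fun h => ?_, ?_⟩⟩,
    fun hn2 => ?_⟩
  · refine IsCleanRing.isStarCleanRing hι fun x => ?_
    obtain ⟨y, hy⟩ := hιφ x
    rw [hy, conj_eq_self_of_real_quadratic hα hK φ hd0]
  · have hq := h.orderOf_eq_totient IsLocalRing.residue_surjective hqn hι fun x hx => by
      obtain ⟨y, hy⟩ := hιφ x
      rw [hy] at hx ⊢
      exact exists_rat_of_imaginary_quadratic hα hK φ hd0 y hx
    rw [hcard] at hq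
    obtain ⟨hpord, hcop⟩ := orderOf_eq_totient_of_pow r.pos.ne' hpn hq
    have hr : (r : ℕ) = 1 := by
      have h1 : (r : ℕ) ≤ 2 := by
        have := card_le_sq_of_quadratic_generator hgen hπ (p := p)
        rw [hcard] at this
        exact (Nat.pow_le_pow_iff_right (Fact.out : p.Prime).one_lt).mp this
      -- This is where exp(G) ≥ 3 enters: φ(exp(G)) is even, hence not coprime to 2.
      have h2 : (r : ℕ) ≠ 2 := fun h2 => by
        rw [h2, Nat.coprime_two_right] at hcop
        exact Nat.not_even_iff_odd.mpr hcop (Nat.totient_even (by omega))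
      have := r.pos
      omega
    rw [hr, pow_one] at hcard
    have hkr := hqp.mp hcard
    refine ⟨not_dvd_of_orderOf_eq_totient ?_ ?_ hpn hkr hpord, hpord, hkr⟩
    · rcases hD with hD | hD <;> rw [hdiscr, hD] <;> omega
    · rw [hdiscr]
      rcases Int.even_or_odd' t with ⟨s, rfl | rfl⟩ <;> ring_nf <;> omega
  · rintro ⟨-, hpord, hkr⟩
    refine isStarCleanRing_of_orderOf_eq_totient hqn ?_
    rw [hqp.mpr hkr, hpord]
  · refine isStarCleanRing_of_orderOf_eq_totient hqn ?_
    have hu : orderOf (Fintype.card 𝔭.ResidueField : ZMod (Monoid.exponent G)) =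
        orderOf (ZMod.unitOfCoprime _ hqn) := by
      rw [← orderOf_units, ZMod.coe_unitOfCoprime]
    have htot : (Monoid.exponent G).totient = 1 := by
      rw [Nat.totient_eq_one_iff]
      have := NeZero.pos (Monoid.exponent G)
      omega
    rw [htot]
    refine Nat.dvd_one.mp ?_
    rw [← htot, hu, ← ZMod.card_units_eq_totient]
    exact orderOf_dvd_card
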